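/- **Corollary (monotone walks).** Let $m>0$ and let $\Gamma$ be a simply connected lattice region in the plane whose boundary $\partial\Gamma=\alpha\cup\eta_+\cup\eta_-\cup\beta$ consists of two vertical intervals $\alpha\subset\{x=0\}$ and $\beta\subset\{x=m\}$ and two $x$-monotone lattice paths: $\eta_-$, joining the bottom ends of $\alpha$ and $\beta$, and $\eta_+$, joining their top ends. (An $x$-monotone lattice path is a path in $\mathbb Z^2$ without self-intersections whose steps are unit steps to the right, up or down; $\eta_-$ lies weakly below $\eta_+$, and the two may touch.) Boundary points belong to $\Gamma$. Let $0<\ell<m$ be an integer, let $\gamma=\{x=\ell\}\cap\Gamma$, and fix lattice points $A=(0,a)\in\alpha$ and $B=(m,b)\in\beta$. Let $\pi_\pm(i,j),\omega_\pm(i,j)$ be transition probabilities, $\mathbf P[(i,j)\to(i\pm1,j)]=\pi_\pm(i,j)$ and $\mathbf P[(i,j)\to(i,j\pm1)]=\omega_\pm(i,j)$, which are nonnegative with $\pi_++\pi_-+\omega_++\omega_-=1$ at every point of $\Gamma$. Assume that they are $y$-invariant, that is, $\pi_\pm(i,j)=\pi_\pm(i,j')$ and $\omega_\pm(i,j)=\omega_\pm(i,j')$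 for all $i,j,j'$, and monotone, that is, $\pi_-(i,j)=\omega_-(i,j)=0$ for all $(i,j)\in\Gamma$. Let $\{X_t\}_{t\ge0}$ be the random walk which starts at $X_0=A$, moves according to these transition probabilities, and is absorbed in a cemetery state whenever it tries to exit $\Gamma$, i.e. to make a step along a unit edge not contained in $\Gamma$. Let $u=m+b-a\ge0$, and let $T$ be the first time $t$ with $X_t\in\gamma$. Let $q(k)$ be the conditional probability that $X_T=(\ell,k)$ given that $X_u=B$ (when $\mathbf P[X_u=B]>0$), or, without normalization, the probability $\mathbf P[X_T=(\ell,k),\,X_u=B]$. With either meaning, $q$ is log-concave: $$q(k)^2\ \ge\ q(k+1)\,q(k-1)\qquad\text{for all } k\in\mathbb Z \text{ such that } (\ell,k\pm1)\in\gamma .$$ -/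

import Mathlib

open MeasureTheory ProbabilityTheory

namespace MonotoneWalk

/-- One step of an `x`-monotone lattice path: a unit step to the right, up or down (never left). -/
def XStep (p q : ℤ × ℤ) : Prop :=
  q = (p.1 + 1, p.2) ∨ q = (p.1, p.2 + 1) ∨ q = (p.1, p.2 - 1)

/-- The list of vertices `η` is an `x`-monotone lattice path from `p` to `q`
(without self-intersections, as befits a boundary curve). -/
structure IsXMonotonePath (η : List (ℤ × ℤ)) (p q : ℤ × ℤ) : Prop where
  chain : η.IsChain XStep
  nodup : η.Nodup
  head_eq : η.head? = some p
  last_eq : η.getLast? = some q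

/-- The path `η` traverses the horizontal edge from `(i, j)` to `(i + 1, j)`. -/
def HasEdge (η : List (ℤ × ℤ)) (i j : ℤ) : Prop :=
  [(i, j), (i + 1, j)] <:+: η

/-- A simply connected lattice region, described by its boundary: the vertical intervals
`α = {0} × [αbot, αtop]` and `β = {m} × [βbot, βtop]`, and two `x`-monotone lattice paths, `lower`
(joining the bottom ends of `α` and `β`) and `upper` (joining the top ends).  Over each strip
`[i, i + 1]` the lower path does not run above the upper one; the paths may touch. -/
structure Region where
  m : ℤ
  m_pos : 0 < m
  αbot : ℤ
  αtop : ℤ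
  βbot : ℤ
  βtop : ℤ
  lower : List (ℤ × ℤ)
  upper : List (ℤ × ℤ)
  αbot_le : αbot ≤ αtop
  βbot_le : βbot ≤ βtop
  lower_path : IsXMonotonePath lower (0, αbot) (m, βbot)
  upper_path : IsXMonotonePath upper (0, αtop) (m, βtop)
  lower_le_upper : ∀ i j j' : ℤ, HasEdge lower i j → HasEdge upper i j' → j ≤ j'

namespace Region

/-- The vertical boundary interval `α` on the line `x = 0`. -/
def alpha (Γ : Region) : Set (ℤ × ℤ) := {p | p.1 = 0 ∧ Γ.αbot ≤ p.2 ∧ p.2 ≤ Γ.αtop}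

/-- The vertical boundary interval `β` on the line `x = m`. -/
def beta (Γ : Region) : Set (ℤ × ℤ) := {p | p.1 = Γ.m ∧ Γ.βbot ≤ p.2 ∧ p.2 ≤ Γ.βtop}

/-- The lattice points of the region (boundary included): those which have a point of the lower
path weakly below and a point of the upper path weakly above them, on the same vertical line. -/
def points (Γ : Region) : Set (ℤ × ℤ) :=
  {p | (∃ j, (p.1, j) ∈ Γ.lower ∧ j ≤ p.2) ∧ ∃ j, (p.1, j) ∈ Γ.upper ∧ p.2 ≤ j}

/-- The horizontal unit edge from `(i, j)` to `(i + 1, j)` lies in the (closed, planar) region. -/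
def HorizontalMem (Γ : Region) (i j : ℤ) : Prop :=
  (∃ d, HasEdge Γ.lower i d ∧ d ≤ j) ∧ ∃ e, HasEdge Γ.upper i e ∧ j ≤ e

/-- The vertical unit edge from `(i, j)` to `(i, j + 1)` lies in the region. -/
def VerticalMem (Γ : Region) (i j : ℤ) : Prop :=
  (i, j) ∈ Γ.points ∧ (i, j + 1) ∈ Γ.points

/-- The vertical interval `γ = {x = ℓ} ∩ Γ`. -/
def gamma (Γ : Region) (ℓ : ℤ) : Set (ℤ × ℤ) := {p | p ∈ Γ.points ∧ p.1 = ℓ}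

end Region

/-- The numbers `π₊, π₋, ω₊, ω₋` attached to the steps right, left, up, down from `(i, j)`. -/
structure StepWeights where
  right : ℤ → ℤ → ℝ
  left : ℤ → ℤ → ℝ
  up : ℤ → ℤ → ℝ
  down : ℤ → ℤ → ℝ

namespace StepWeights

/-- The weights are transition probabilities at all points of the region. -/
structure IsTransition (w : StepWeights) (Γ : Region) : Prop where
  right_nonneg : ∀ i j, (i, j) ∈ Γ.points → 0 ≤ w.right i j
  left_nonneg : ∀ i j, (i, j) ∈ Γ.points → 0 ≤ w.left i j
  up_nonneg : ∀ i j, (i, j) ∈ Γ.points → 0 ≤ w.up i j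
  down_nonneg : ∀ i j, (i, j) ∈ Γ.points → 0 ≤ w.down i j
  sum_eq_one : ∀ i j, (i, j) ∈ Γ.points → w.right i j + w.left i j + w.up i j + w.down i j = 1

/-- Invariance under vertical shifts. -/
def YInvariant (w : StepWeights) : Prop :=
  ∀ i j j' : ℤ, w.right i j = w.right i j' ∧ w.left i j = w.left i j' ∧
    w.up i j = w.up i j' ∧ w.down i j = w.down i j'

/-- The walk makes no steps left or down. -/
def IsMonotone (w : StepWeights) (Γ : Region) : Prop :=
  ∀ i j, (i, j) ∈ Γ.points → w.left i j = 0 ∧ w.down i j = 0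

end StepWeights

open Classical in
/-- One-step transition probabilities of the walk in `Γ`.  The state `none` is the cemetery state:
a walk at `(i, j)` chooses one of the four steps with probabilities `w`, moves if the chosen edge
lies in `Γ`, and otherwise is absorbed in `none` forever. -/
noncomputable def stepProb (Γ : Region) (w : StepWeights) :
    Option (ℤ × ℤ) → Option (ℤ × ℤ) → ℝ
  | none, y => if y = none then 1 else 0
  | some (i, j), y =>
      (if y = (if Γ.HorizontalMem i j then some (i + 1, j) else none) then w.right i j else 0)
    + (if y = (if Γ.HorizontalMem (i - 1) j then some (i - 1, j) else none)
        then w.left i j else 0)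
    + (if y = (if Γ.VerticalMem i j then some (i, j + 1) else none) then w.up i j else 0)
    + (if y = (if Γ.VerticalMem i (j - 1) then some (i, j - 1) else none)
        then w.down i j else 0)

open Classical in
/-- `X` is (a version of) the random walk in `Γ` with step probabilities `w` which starts at `A` and
is absorbed whenever it tries to exit `Γ`: the Markov chain with initial state `A` and transition
probabilities `stepProb Γ w`, given through its finite-dimensional distributions. -/
structure IsAbsorbedWalk {Ω : Type*} [MeasurableSpace Ω] (μ : Measure Ω) (Γ : Region)
    (w : StepWeights) (A : ℤ × ℤ) (X : ℕ → Ω → Option (ℤ × ℤ)) : Prop where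
  measurableSet_eq : ∀ (t : ℕ) (y : Option (ℤ × ℤ)), MeasurableSet {ω | X t ω = y}
  law : ∀ (n : ℕ) (x : ℕ → Option (ℤ × ℤ)),
    μ.real {ω | ∀ t ≤ n, X t ω = x t} =
      (if x 0 = some A then 1 else 0) * ∏ t ∈ Finset.range n, stepProb Γ w (x t) (x (t + 1))

/-- The event that `X_T = (ℓ, k)`, where `T` is the first time `t` with `X_t ∈ γ = {x = ℓ} ∩ Γ`. -/
def firstHit {Ω : Type*} (Γ : Region) (X : ℕ → Ω → Option (ℤ × ℤ)) (ℓ k : ℤ) : Set Ω :=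
  {ω | ∃ T : ℕ, IsLeast {t : ℕ | ∃ p ∈ Γ.gamma ℓ, X t ω = some p} T ∧ X T ω = some (ℓ, k)}

/-- The probability that the walk first hits `γ` at `(ℓ, k)` and is at `B` at time `u`. -/
noncomputable def jointHitProb {Ω : Type*} [MeasurableSpace Ω] (μ : Measure Ω) (Γ : Region)
    (X : ℕ → Ω → Option (ℤ × ℤ)) (B : ℤ × ℤ) (u : ℕ) (ℓ k : ℤ) : ℝ :=
  μ.real (firstHit Γ X ℓ k ∩ {ω | X u ω = some B})

/-- The conditional probability that the walk first hits `γ` at `(ℓ, k)`, given that it is at `B` at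
time `u`. -/
noncomputable def condHitProb {Ω : Type*} [MeasurableSpace Ω] (μ : Measure Ω) (Γ : Region)
    (X : ℕ → Ω → Option (ℤ × ℤ)) (B : ℤ × ℤ) (u : ℕ) (ℓ k : ℤ) : ℝ :=
  (ProbabilityTheory.cond μ {ω | X u ω = some B}).real (firstHit Γ X ℓ k)

end MonotoneWalk

/-!
The walk only moves right and up, with probabilities depending on the column alone.  A trajectory
from `(0, a)` to `(m, b)` is therefore determined by the heights at which it crosses from column to
column, and its first point on `x = ℓ` is the right end of the edge by which it enters this column.
Accordingly the probability in question is, as a function of the height `k`, a product of three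
factors (`IsAbsorbedWalk.jointHitProb_eq`): the probability `visit` of getting to `(ℓ - 1, k)`, the
probability `rightWeight` of the step to `(ℓ, k)`, and the probability `reach` of getting from there
to `(m, b)`.  A product of log-concave sequences is log-concave, so it suffices to treat each factor.

The step probability is constant on the interval of heights whose edges lie in the region, and zero
elsewhere.  The other two factors are followed from column to column.  If `φ j` is the probability of
entering column `i` at height `j`, then the probability `g j` of visiting `(i, j)` satisfies
`g j = φ j + q * g (j - 1)` as long as `(i, j)` is in the region, where `q` is the probability of a
step up in this column; that is, `g` is the convolution of `φ` with a geometric sequence, killed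
outside an interval.  Such convolutions preserve log-concavity without internal zeros
(`IsLogConcave.geom_conv`), and so does the passage to the next column, which multiplies by a
multiple of the indicator of an interval.  Starting from a point mass, this gives
`isLogConcave_visit`, and its mirror image gives `isLogConcave_reach`.
-/

namespace MonotoneWalk

/-! ### Log-concave sequences on `ℤ` -/

/-- Log-concavity of a nonnegative sequence on `ℤ`.  The inequality is required for all `x ≤ y`
and not only for `x = y`, which excludes internal zeros; without this, log-concavity would not
survive convolutions. -/
structure IsLogConcave (f : ℤ → ℝ) : Prop where
  nonneg : ∀ x, 0 ≤ f x
  mul_le : ∀ x y, x ≤ y → f (x - 1) * f (y + 1) ≤ f x * f y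

namespace IsLogConcave

variable {f g : ℤ → ℝ}

lemma mul_le_of_add_le (hf : IsLogConcave f) (n : ℕ) :
    ∀ x z : ℤ, x + n ≤ z - n → f x * f z ≤ f (x + n) * f (z - n) := by
  induction n with
  | zero => intro x z _; simp
  | succ n ih =>
    intro x z h
    push_cast at h ⊢
    have h1 := ih x z (by omega)
    have h2 := hf.mul_le (x + n + 1) (z - n - 1) (by omega)
    rw [show x + (n : ℤ) + 1 - 1 = x + n by ring, show z - (n : ℤ) - 1 + 1 = z - n by ring] at h2
    rw [show x + ((n : ℤ) + 1) = x + n + 1 by ring, show z - ((n : ℤ) + 1) = z - n - 1 by ring]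
    exact h1.trans h2

/-- Moving two arguments of a log-concave sequence by the same amount towards (or past) each other,
within the interval they span, increases the product of the values. -/
lemma mul_le_mul_shift (hf : IsLogConcave f) {x z c : ℤ} (hc : 0 ≤ c) (h : x ≤ z - c) :
    f x * f z ≤ f (x + c) * f (z - c) := by
  rcases le_total (x + c) (z - c) with h1 | h1
  · obtain ⟨n, rfl⟩ := Int.eq_ofNat_of_zero_le hc
    exact hf.mul_le_of_add_le n x z h1
  · obtain ⟨n, hn⟩ := Int.eq_ofNat_of_zero_le (show 0 ≤ z - x - c by omega)
    have := hf.mul_le_of_add_le n x z (by omega)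
    rw [show x + (n : ℤ) = z - c by omega, show z - (n : ℤ) = x + c by omega] at this
    linarith

lemma single (a : ℤ) : IsLogConcave (fun x => if x = a then 1 else 0) := by
  refine ⟨fun x => by positivity, fun x y h => ?_⟩
  have : ¬ (x - 1 = a ∧ y + 1 = a) := by omega
  by_cases h1 : x - 1 = a
  · have h2 : y + 1 ≠ a := fun h2 => this ⟨h1, h2⟩
    simp only [if_neg h2, mul_zero]
    positivity
  · simp only [if_neg h1, zero_mul]
    positivity

lemma mul (hf : IsLogConcave f) (hg : IsLogConcave g) : IsLogConcave (fun x => f x * g x) := by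
  refine ⟨fun x => mul_nonneg (hf.nonneg x) (hg.nonneg x), fun x y h => ?_⟩
  have := mul_le_mul (hf.mul_le x y h) (hg.mul_le x y h)
    (mul_nonneg (hg.nonneg _) (hg.nonneg _)) (mul_nonneg (hf.nonneg _) (hf.nonneg _))
  linarith

open Classical in
lemma const_on {S : Set ℤ} (hS : S.OrdConnected) {c : ℝ} (hc : 0 ≤ c) :
    IsLogConcave (fun x => if x ∈ S then c else 0) := by
  refine ⟨fun x => by positivity, fun x y h => ?_⟩
  by_cases h1 : x - 1 ∈ S
  · by_cases h2 : y + 1 ∈ S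
    · have hx : x ∈ S := hS.out h1 h2 ⟨by omega, by omega⟩
      have hy : y ∈ S := hS.out h1 h2 ⟨by omega, by omega⟩
      simp [h1, h2, hx, hy]
    · simp only [if_neg h2, mul_zero]
      positivity
  · simp only [if_neg h1, zero_mul]
    positivity

lemma comp_neg (hf : IsLogConcave f) : IsLogConcave (fun x => f (-x)) := by
  refine ⟨fun x => hf.nonneg _, fun x y h => ?_⟩
  have := hf.mul_le (-y) (-x) (by omega)
  rw [show -(x - 1) = -x + 1 by ring, show -(y + 1) = -y - 1 by ring]
  linarith

/-- The comparison behind the preservation of log-concavity under convolution with a geometric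
sequence: `f` and the convolved sequence `g` satisfy a mixed version of the shift inequality. -/
lemma mul_geom_le (hf : IsLogConcave f) {C : Set ℤ} (hC : C.OrdConnected) {q : ℝ} (hq : 0 ≤ q)
    {g : ℤ → ℝ} (hg : ∀ x, 0 ≤ g x) (hgC : ∀ x ∉ C, g x = 0)
    (hrec : ∀ x ∈ C, g x = f x + q * g (x - 1)) {z c : ℤ} (hz : z ∈ C) (hc : 0 ≤ c)
    {x₀ : ℤ} (h₀ : ∀ x < x₀, g x = 0) (n : ℕ) :
    ∀ x < x₀ + n, x ≤ z - c → f z * g x ≤ f (z - c) * g (x + c) := by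
  induction n with
  | zero =>
    intro x hx _
    rw [h₀ x (by simpa using hx), mul_zero]
    exact mul_nonneg (hf.nonneg _) (hg _)
  | succ n ih =>
    intro x hx hxz
    push_cast at hx
    by_cases hxC : x ∈ C
    · have hxcC : x + c ∈ C := hC.out hxC hz ⟨by omega, by omega⟩
      rw [hrec x hxC, hrec (x + c) hxcC]
      have h1 := ih (x - 1) (by omega) (by omega)
      rw [show x - 1 + c = x + c - 1 by ring] at h1
      have h2 := hf.mul_le_mul_shift hc hxz
      have h3 := mul_le_mul_of_nonneg_left h1 hq
      linarith
    · rw [hgC x hxC, mul_zero]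
      exact mul_nonneg (hf.nonneg _) (hg _)

/-- The convolution of a log-concave sequence with a geometric one, killed outside an interval
`C`, is log-concave.  The convolution is given by its first-order recursion. -/
lemma geom_conv (hf : IsLogConcave f) {C : Set ℤ} (hC : C.OrdConnected) {q : ℝ} (hq : 0 ≤ q)
    (hg : ∀ x, 0 ≤ g x) (hgC : ∀ x ∉ C, g x = 0)
    (hrec : ∀ x ∈ C, g x = f x + q * g (x - 1))
    {x₀ : ℤ} (h₀ : ∀ x < x₀, g x = 0) : IsLogConcave g := by
  refine ⟨hg, fun x y hxy => ?_⟩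
  have hpos : 0 ≤ g x * g y := mul_nonneg (hg _) (hg _)
  by_cases h1 : x - 1 ∈ C
  · by_cases h2 : y + 1 ∈ C
    · have hx : x ∈ C := hC.out h1 h2 ⟨by omega, by omega⟩
      have key := hf.mul_geom_le hC hq hg hgC hrec h2 (c := y + 1 - x) (by omega) h₀
        (x - x₀).toNat (x - 1) (by omega) (by omega)
      rw [show y + 1 - (y + 1 - x) = x by ring, show x - 1 + (y + 1 - x) = y by ring] at key
      rw [hrec x hx, hrec (y + 1) h2, show y + 1 - 1 = y by ring]
      linarith
    · rw [hgC _ h2, mul_zero]; exact hpos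
  · rw [hgC _ h1, zero_mul]; exact hpos

/-- The mirror image of `IsLogConcave.geom_conv`. -/
lemma geom_conv' (hf : IsLogConcave f) {C : Set ℤ} (hC : C.OrdConnected) {q : ℝ} (hq : 0 ≤ q)
    (hg : ∀ x, 0 ≤ g x) (hgC : ∀ x ∉ C, g x = 0)
    (hrec : ∀ x ∈ C, g x = f x + q * g (x + 1))
    {x₀ : ℤ} (h₀ : ∀ x, x₀ < x → g x = 0) : IsLogConcave g := by
  have hC' : (Neg.neg ⁻¹' C).OrdConnected :=
    ⟨fun x hx y hy z hz => hC.out hy hx ⟨neg_le_neg hz.2, neg_le_neg hz.1⟩⟩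
  have := geom_conv (g := fun x => g (-x)) (x₀ := -x₀) hf.comp_neg hC' hq (fun x => hg _)
    (fun x hx => hgC _ hx)
    (fun x hx => by rw [hrec _ hx, show -(x - 1) = -x + 1 by ring])
    (fun x hx => h₀ _ (by omega))
  simpa using this.comp_neg

end IsLogConcave

/-! ### The geometry of the region -/

namespace Region

variable {Γ : Region}

lemma HorizontalMem.left_mem {i j : ℤ} (h : Γ.HorizontalMem i j) : (i, j) ∈ Γ.points := by
  obtain ⟨⟨d, hd, hdj⟩, e, he, hje⟩ := h
  exact ⟨⟨d, hd.subset (by simp), hdj⟩, e, he.subset (by simp), hje⟩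

lemma HorizontalMem.right_mem {i j : ℤ} (h : Γ.HorizontalMem i j) : (i + 1, j) ∈ Γ.points := by
  obtain ⟨⟨d, hd, hdj⟩, e, he, hje⟩ := h
  exact ⟨⟨d, hd.subset (by simp), hdj⟩, e, he.subset (by simp), hje⟩

lemma ordConnected_horizontalMem (Γ : Region) (i : ℤ) :
    {j | Γ.HorizontalMem i j}.OrdConnected := by
  refine ⟨?_⟩
  rintro x ⟨⟨d, hd, hdx⟩, -⟩ y ⟨-, e, he, hye⟩ z ⟨hxz, hzy⟩
  exact ⟨⟨d, hd, hdx.trans hxz⟩, e, he, hzy.trans hye⟩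

lemma ordConnected_column (Γ : Region) (i : ℤ) : {j | (i, j) ∈ Γ.points}.OrdConnected := by
  refine ⟨?_⟩
  rintro x ⟨⟨d, hd, hdx⟩, -⟩ y ⟨-, e, he, hye⟩ z ⟨hxz, hzy⟩
  exact ⟨⟨d, hd, le_trans hdx hxz⟩, e, he, le_trans hzy hye⟩

lemma alpha_subset_points (Γ : Region) : Γ.alpha ⊆ Γ.points := by
  rintro ⟨i, j⟩ ⟨rfl, h1, h2⟩
  exact ⟨⟨_, List.mem_of_head? Γ.lower_path.head_eq, h1⟩,
    _, List.mem_of_head? Γ.upper_path.head_eq, h2⟩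

lemma beta_subset_points (Γ : Region) : Γ.beta ⊆ Γ.points := by
  rintro ⟨i, j⟩ ⟨rfl, h1, h2⟩
  exact ⟨⟨_, List.mem_of_getLast? Γ.lower_path.last_eq, h1⟩,
    _, List.mem_of_getLast? Γ.upper_path.last_eq, h2⟩

end Region

/-! ### Step weights and partition functions of monotone walks -/

section Weights

variable (Γ : Region) (w : StepWeights)

open Classical in
/-- The probability of a successful step to the right from `(i, j)`. -/
noncomputable def rightWeight (i j : ℤ) : ℝ := if Γ.HorizontalMem i j then w.right i j else 0

open Classical in
/-- The probability of a successful step up from `(i, j)`. -/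
noncomputable def upWeight (i j : ℤ) : ℝ := if Γ.VerticalMem i j then w.up i j else 0

/-- The probability that the monotone walk started at `(0, a)` is at `(i, j)` at time `n`. -/
noncomputable def fwd (a : ℤ) : ℕ → ℤ → ℤ → ℝ
  | 0, i, j => if i = 0 ∧ j = a then 1 else 0
  | n + 1, i, j => fwd a n (i - 1) j * rightWeight Γ w (i - 1) j
      + fwd a n i (j - 1) * upWeight Γ w i (j - 1)

/-- The probability that the monotone walk started at `(i, j)` is at `(m, b)` at time `n`. -/
noncomputable def bwd (b : ℤ) : ℕ → ℤ → ℤ → ℝ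
  | 0, i, j => if i = Γ.m ∧ j = b then 1 else 0
  | n + 1, i, j => rightWeight Γ w i j * bwd b n (i + 1) j
      + upWeight Γ w i j * bwd b n i (j + 1)

/-- The probability that the walk started at `(0, a)` ever visits `(i, j)`.  The only possible time
is `i + j - a`; for a negative value of it, `fwd` is evaluated at time `0` away from `(0, a)`, and
vanishes. -/
noncomputable def visit (a i j : ℤ) : ℝ := fwd Γ w a (i + j - a).toNat i j

/-- The probability that the walk started at `(i, j)` ever visits `(m, b)`. -/
noncomputable def reach (b i j : ℤ) : ℝ := bwd Γ w b (Γ.m + b - i - j).toNat i j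

variable {Γ w}

lemma rightWeight_eq (hw : w.IsTransition Γ) (hinv : w.YInvariant) (i j : ℤ)
    [Decidable (j ∈ {j | Γ.HorizontalMem i j})] :
    rightWeight Γ w i j = if j ∈ {j | Γ.HorizontalMem i j} then |w.right i 0| else 0 := by
  unfold rightWeight
  by_cases h : Γ.HorizontalMem i j
  · rw [if_pos h, if_pos (by exact h), (hinv i 0 j).1,
      abs_of_nonneg (hw.right_nonneg i j h.left_mem)]
  · rw [if_neg h, if_neg (by exact h)]

/-- Along a column, the probability of a step to the right is log-concave: it is constant on the
interval of edges in the region. -/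
lemma isLogConcave_rightWeight (hw : w.IsTransition Γ) (hinv : w.YInvariant) (i : ℤ) :
    IsLogConcave (rightWeight Γ w i) := by
  classical
  have := IsLogConcave.const_on (Γ.ordConnected_horizontalMem i) (abs_nonneg (w.right i 0))
  convert this using 1
  funext j
  exact rightWeight_eq hw hinv i j

lemma rightWeight_eq_zero {i j : ℤ} (h : ¬ Γ.HorizontalMem i j) : rightWeight Γ w i j = 0 :=
  if_neg h

lemma upWeight_eq_zero {i j : ℤ} (h : ¬ Γ.VerticalMem i j) : upWeight Γ w i j = 0 := if_neg h

lemma upWeight_eq_abs (hw : w.IsTransition Γ) (hinv : w.YInvariant) {i j : ℤ}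
    (h : Γ.VerticalMem i j) : upWeight Γ w i j = |w.up i 0| := by
  rw [upWeight, if_pos h, (hinv i 0 j).2.2.1, abs_of_nonneg (hw.up_nonneg i j h.1)]

lemma upWeight_nonneg (hw : w.IsTransition Γ) (hinv : w.YInvariant) (i j : ℤ) :
    0 ≤ upWeight Γ w i j := by
  by_cases h : Γ.VerticalMem i j
  · rw [upWeight_eq_abs hw hinv h]; exact abs_nonneg _
  · rw [upWeight_eq_zero h]

lemma fwd_nonneg (hw : w.IsTransition Γ) (hinv : w.YInvariant) (a : ℤ) (n : ℕ) :
    ∀ i j, 0 ≤ fwd Γ w a n i j := by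
  induction n with
  | zero => intro i j; unfold fwd; positivity
  | succ n ih =>
    intro i j
    exact add_nonneg (mul_nonneg (ih _ _) ((isLogConcave_rightWeight hw hinv _).nonneg _))
      (mul_nonneg (ih _ _) (upWeight_nonneg hw hinv _ _))

lemma bwd_nonneg (hw : w.IsTransition Γ) (hinv : w.YInvariant) (b : ℤ) (n : ℕ) :
    ∀ i j, 0 ≤ bwd Γ w b n i j := by
  induction n with
  | zero => intro i j; unfold bwd; positivity
  | succ n ih =>
    intro i j
    exact add_nonneg (mul_nonneg ((isLogConcave_rightWeight hw hinv _).nonneg _) (ih _ _))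
      (mul_nonneg (upWeight_nonneg hw hinv _ _) (ih _ _))

lemma fwd_eq_zero_of_lt (a : ℤ) (n : ℕ) : ∀ i j, i < 0 ∨ j < a → fwd Γ w a n i j = 0 := by
  induction n with
  | zero => intro i j h; exact if_neg (by omega)
  | succ n ih =>
    intro i j h
    rw [fwd, ih _ _ (by omega), ih _ _ (by omega), zero_mul, zero_mul, add_zero]

lemma bwd_eq_zero_of_lt (b : ℤ) (n : ℕ) : ∀ i j, Γ.m < i ∨ b < j → bwd Γ w b n i j = 0 := by
  induction n with
  | zero => intro i j h; exact if_neg (by omega)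
  | succ n ih =>
    intro i j h
    rw [bwd, ih _ _ (by omega), ih _ _ (by omega), mul_zero, mul_zero, add_zero]

lemma fwd_eq_zero_of_notMem {a : ℤ} (ha : (0, a) ∈ Γ.points) (n : ℕ) {i j : ℤ}
    (h : (i, j) ∉ Γ.points) : fwd Γ w a n i j = 0 := by
  cases n with
  | zero => exact if_neg (by rintro ⟨rfl, rfl⟩; exact h ha)
  | succ n =>
    rw [fwd, rightWeight_eq_zero, upWeight_eq_zero, mul_zero, mul_zero, add_zero]
    · intro h'; exact h (by simpa using h'.2)
    · intro h'; exact h (by simpa using h'.right_mem)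

lemma bwd_eq_zero_of_notMem {b : ℤ} (hb : (Γ.m, b) ∈ Γ.points) (n : ℕ) {i j : ℤ}
    (h : (i, j) ∉ Γ.points) : bwd Γ w b n i j = 0 := by
  cases n with
  | zero => exact if_neg (by rintro ⟨rfl, rfl⟩; exact h hb)
  | succ n =>
    rw [bwd, rightWeight_eq_zero, upWeight_eq_zero, zero_mul, zero_mul, add_zero]
    · intro h'; exact h h'.1
    · intro h'; exact h h'.left_mem

lemma visit_eq (a i j : ℤ) :
    visit Γ w a i j = (if i = 0 ∧ j = a then 1 else 0)
      + visit Γ w a (i - 1) j * rightWeight Γ w (i - 1) j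
      + visit Γ w a i (j - 1) * upWeight Γ w i (j - 1) := by
  unfold visit
  rcases lt_or_ge 0 (i + j - a) with h | h
  · obtain ⟨n, hn⟩ := Int.eq_ofNat_of_zero_le (show 0 ≤ i + j - a - 1 by omega)
    rw [show (i + j - a).toNat = n + 1 by omega, show (i - 1 + j - a).toNat = n by omega,
      show (i + (j - 1) - a).toNat = n by omega, if_neg (by omega), fwd, zero_add]
  · rw [show (i + j - a).toNat = 0 by omega, show (i - 1 + j - a).toNat = 0 by omega,
      show (i + (j - 1) - a).toNat = 0 by omega, fwd, fwd, fwd,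
      if_neg (show ¬ (i - 1 = 0 ∧ j = a) by omega), if_neg (show ¬ (i = 0 ∧ j - 1 = a) by omega)]
    ring

lemma reach_eq (b i j : ℤ) :
    reach Γ w b i j = (if i = Γ.m ∧ j = b then 1 else 0)
      + rightWeight Γ w i j * reach Γ w b (i + 1) j
      + upWeight Γ w i j * reach Γ w b i (j + 1) := by
  unfold reach
  rcases lt_or_ge 0 (Γ.m + b - i - j) with h | h
  · obtain ⟨n, hn⟩ := Int.eq_ofNat_of_zero_le (show 0 ≤ Γ.m + b - i - j - 1 by omega)
    rw [show (Γ.m + b - i - j).toNat = n + 1 by omega,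
      show (Γ.m + b - (i + 1) - j).toNat = n by omega,
      show (Γ.m + b - i - (j + 1)).toNat = n by omega, if_neg (by omega), bwd, zero_add]
  · rw [show (Γ.m + b - i - j).toNat = 0 by omega,
      show (Γ.m + b - (i + 1) - j).toNat = 0 by omega,
      show (Γ.m + b - i - (j + 1)).toNat = 0 by omega, bwd, bwd, bwd,
      if_neg (show ¬ (i + 1 = Γ.m ∧ j = b) by omega),
      if_neg (show ¬ (i = Γ.m ∧ j + 1 = b) by omega)]
    ring

/-- One column of the forward induction: the heights at which the walk enters column `i` determine
the visits to it by a geometric convolution. -/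
lemma isLogConcave_visit_of_source (hw : w.IsTransition Γ) (hinv : w.YInvariant) {a : ℤ}
    (ha : (0, a) ∈ Γ.points) (i : ℤ)
    (h : IsLogConcave (fun j => (if i = 0 ∧ j = a then 1 else 0)
      + visit Γ w a (i - 1) j * rightWeight Γ w (i - 1) j)) :
    IsLogConcave (visit Γ w a i) := by
  refine h.geom_conv (Γ.ordConnected_column i) (abs_nonneg (w.up i 0))
    (fun j => fwd_nonneg hw hinv a _ i j) (fun j hj => fwd_eq_zero_of_notMem ha _ hj) ?_
    (x₀ := a) (fun j hj => fwd_eq_zero_of_lt a _ i j (Or.inr hj))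
  intro j hj
  rw [visit_eq]
  congr 1
  by_cases hj' : (i, j - 1) ∈ Γ.points
  · rw [upWeight_eq_abs hw hinv ⟨hj', by simpa using hj⟩, mul_comm]
  · rw [show visit Γ w a i (j - 1) = 0 from fwd_eq_zero_of_notMem ha _ hj', mul_zero, zero_mul]

lemma isLogConcave_visit (hw : w.IsTransition Γ) (hinv : w.YInvariant) {a : ℤ}
    (ha : (0, a) ∈ Γ.points) (n : ℕ) : IsLogConcave (visit Γ w a n) := by
  induction n with
  | zero =>
    refine isLogConcave_visit_of_source hw hinv ha _ ?_
    convert IsLogConcave.single a using 2 with j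
    rw [show visit Γ w a (((0 : ℕ) : ℤ) - 1) j = 0 from
      fwd_eq_zero_of_lt a _ _ j (Or.inl (by norm_num))]
    simp
  | succ n ih =>
    refine isLogConcave_visit_of_source hw hinv ha _ ?_
    convert ih.mul (isLogConcave_rightWeight hw hinv n) using 2 with j
    rw [if_neg (by omega), zero_add, show ((n + 1 : ℕ) : ℤ) - 1 = n by omega]

/-- One column of the backward induction. -/
lemma isLogConcave_reach_of_source (hw : w.IsTransition Γ) (hinv : w.YInvariant) {b : ℤ}
    (hb : (Γ.m, b) ∈ Γ.points) (i : ℤ)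
    (h : IsLogConcave (fun j => (if i = Γ.m ∧ j = b then 1 else 0)
      + rightWeight Γ w i j * reach Γ w b (i + 1) j)) :
    IsLogConcave (reach Γ w b i) := by
  refine h.geom_conv' (Γ.ordConnected_column i) (abs_nonneg (w.up i 0))
    (fun j => bwd_nonneg hw hinv b _ i j) (fun j hj => bwd_eq_zero_of_notMem hb _ hj) ?_
    (x₀ := b) (fun j hj => bwd_eq_zero_of_lt b _ i j (Or.inr hj))
  intro j hj
  rw [reach_eq]
  congr 1
  by_cases hj' : (i, j + 1) ∈ Γ.points
  · rw [upWeight_eq_abs hw hinv ⟨hj, hj'⟩]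
  · rw [show reach Γ w b i (j + 1) = 0 from bwd_eq_zero_of_notMem hb _ hj', mul_zero, mul_zero]

lemma isLogConcave_reach (hw : w.IsTransition Γ) (hinv : w.YInvariant) {b : ℤ}
    (hb : (Γ.m, b) ∈ Γ.points) (n : ℕ) : IsLogConcave (reach Γ w b (Γ.m - n)) := by
  induction n with
  | zero =>
    refine isLogConcave_reach_of_source hw hinv hb _ ?_
    convert IsLogConcave.single b using 2 with j
    rw [show reach Γ w b (Γ.m - ((0 : ℕ) : ℤ) + 1) j = 0 from
      bwd_eq_zero_of_lt b _ _ j (Or.inl (by simp))]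
    simp
  | succ n ih =>
    refine isLogConcave_reach_of_source hw hinv hb _ ?_
    convert (isLogConcave_rightWeight hw hinv _).mul ih using 2 with j
    rw [if_neg (by omega), zero_add, show Γ.m - ((n + 1 : ℕ) : ℤ) + 1 = Γ.m - n by omega]

/-! ### The transition probabilities of a monotone walk -/

open Classical in
lemma ite_some_eq {c : Prop} {i j i' j' : ℤ} (v : ℝ) [Decidable c]
    [Decidable (some (i, j) = if c then some (i', j') else none)] :
    (if some (i, j) = (if c then some (i', j') else none) then v else 0) =
      if c ∧ i = i' ∧ j = j' then v else 0 := by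
  by_cases h : c <;> simp [h]

lemma stepProb_right (i j : ℤ) :
    stepProb Γ w (some (i, j)) (some (i + 1, j)) = rightWeight Γ w i j := by
  simp only [stepProb, ite_some_eq, rightWeight]
  rw [if_neg (show ¬ (_ ∧ i + 1 = i - 1 ∧ j = j) by omega),
    if_neg (show ¬ (_ ∧ i + 1 = i ∧ j = j + 1) by omega),
    if_neg (show ¬ (_ ∧ i + 1 = i ∧ j = j - 1) by omega)]
  by_cases h : Γ.HorizontalMem i j <;> simp [h]

lemma stepProb_up (i j : ℤ) :
    stepProb Γ w (some (i, j)) (some (i, j + 1)) = upWeight Γ w i j := by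
  simp only [stepProb, ite_some_eq, upWeight]
  rw [if_neg (show ¬ (_ ∧ i = i + 1 ∧ j + 1 = j) by omega),
    if_neg (show ¬ (_ ∧ i = i - 1 ∧ j + 1 = j) by omega),
    if_neg (show ¬ (_ ∧ i = i ∧ j + 1 = j - 1) by omega)]
  by_cases h : Γ.VerticalMem i j <;> simp [h]

/-- A point is entered with positive probability only along an edge of the region, from the left or
from below. -/
lemma exists_of_stepProb_ne_zero (hmono : w.IsMonotone Γ) {x : Option (ℤ × ℤ)} {i j : ℤ}
    (h : stepProb Γ w x (some (i, j)) ≠ 0) :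
    (x = some (i - 1, j) ∧ Γ.HorizontalMem (i - 1) j) ∨
      (x = some (i, j - 1) ∧ Γ.VerticalMem i (j - 1)) := by
  rcases x with _ | ⟨i', j'⟩
  · simp [stepProb] at h
  by_contra hcon
  apply h
  simp only [stepProb, ite_some_eq]
  rw [if_neg, if_neg (c := Γ.VerticalMem i' j' ∧ _)]
  · have hl : Γ.HorizontalMem (i' - 1) j' → w.left i' j' = 0 := fun h' =>
      (hmono i' j' (by simpa using h'.right_mem)).1
    have hd : Γ.VerticalMem i' (j' - 1) → w.down i' j' = 0 := fun h' =>
      (hmono i' j' (by simpa using h'.2)).2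
    split_ifs with h1 h2 h2
    · rw [hl h1.1, hd h2.1]; simp
    · rw [hl h1.1]; simp
    · rw [hd h2.1]; simp
    · simp
  · rintro ⟨h1, rfl, rfl⟩
    exact hcon (Or.inr (by simpa using h1))
  · rintro ⟨h1, rfl, rfl⟩
    exact hcon (Or.inl (by simpa using h1))

end Weights

/-! ### Trajectories -/

section Trajectory

variable {Γ : Region} {w : StepWeights} {x : ℕ → Option (ℤ × ℤ)}

/-- Before visiting `(i, j)` the walk was not absorbed, was weakly to the left of it, and its sum of
coordinates grew by one per step: the time between two points is determined by the points. -/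
lemma exists_some_of_le (hmono : w.IsMonotone Γ) (hx : ∀ t, stepProb Γ w (x t) (x (t + 1)) ≠ 0)
    {s t : ℕ} (hst : s ≤ t) {i j : ℤ} (ht : x t = some (i, j)) :
    ∃ i' j', x s = some (i', j') ∧ i' ≤ i ∧ i + j = i' + j' + (t - s : ℕ) := by
  induction t, hst using Nat.le_induction generalizing i j with
  | base => exact ⟨i, j, ht, le_rfl, by simp⟩
  | succ t hst ih =>
    have h := hx t
    rw [ht] at h
    rcases exists_of_stepProb_ne_zero hmono h with ⟨h, -⟩ | ⟨h, -⟩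
    · obtain ⟨i', j', h1, h2, h3⟩ := ih h
      exact ⟨i', j', h1, by omega, by omega⟩
    · obtain ⟨i', j', h1, h2, h3⟩ := ih h
      exact ⟨i', j', h1, by omega, by omega⟩

/-- For a trajectory ending at `(m, b)`, hitting `γ` first at `(ℓ, k)` means crossing from
`(ℓ - 1, k)` to `(ℓ, k)`, and this can only occur at one time. -/
lemma isLeast_iff (hmono : w.IsMonotone Γ) (hx : ∀ t, stepProb Γ w (x t) (x (t + 1)) ≠ 0)
    {a b ℓ k : ℤ} {u : ℕ} (hℓ0 : 0 < ℓ) (hℓm : ℓ < Γ.m) (h0 : x 0 = some (0, a))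
    (hu : x u = some (Γ.m, b)) :
    (∃ T : ℕ, IsLeast {t : ℕ | ∃ p ∈ Γ.gamma ℓ, x t = some p} T ∧ x T = some (ℓ, k)) ↔
      ∃ n r : ℕ, (n : ℤ) = ℓ - 1 + k - a ∧ n + 1 + r = u ∧ x n = some (ℓ - 1, k) ∧
        x (n + 1) = some (ℓ, k) := by
  constructor
  · rintro ⟨T, ⟨⟨p, hp, hTp⟩, hmin⟩, hT⟩
    have hTu : T ≤ u := by
      by_contra hcon
      obtain ⟨i', j', h1, h2, -⟩ := exists_some_of_le hmono hx (le_of_not_ge hcon) hT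
      rw [hu] at h1
      simp only [Option.some.injEq, Prod.mk.injEq] at h1
      omega
    obtain ⟨i', j', h1, h2, h3⟩ := exists_some_of_le hmono hx (Nat.zero_le T) hT
    rw [h0] at h1
    simp only [Option.some.injEq, Prod.mk.injEq] at h1
    obtain ⟨n, rfl⟩ : ∃ n, T = n + 1 := by
      refine Nat.exists_eq_succ_of_ne_zero ?_
      rintro rfl
      rw [h0] at hT
      simp only [Option.some.injEq, Prod.mk.injEq] at hT
      omega
    obtain ⟨r, hr⟩ := Nat.exists_eq_add_of_le hTu
    refine ⟨n, r, by omega, hr.symm, ?_, hT⟩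
    have h := hx n
    rw [hT] at h
    rcases exists_of_stepProb_ne_zero hmono h with ⟨h, -⟩ | ⟨h, hV⟩
    · exact h
    · have := hmin (show n ∈ _ from ⟨(ℓ, k - 1), ⟨hV.1, rfl⟩, h⟩)
      omega
  · rintro ⟨n, r, -, -, h1, h2⟩
    refine ⟨n + 1, ⟨⟨(ℓ, k), ⟨?_, rfl⟩, h2⟩, ?_⟩, h2⟩
    · have h := hx n
      rw [h2] at h
      rcases exists_of_stepProb_ne_zero hmono h with ⟨h, hH⟩ | ⟨h, hV⟩
      · simpa using hH.right_mem
      · simpa using hV.2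
    · rintro t ⟨⟨p1, p2⟩, ⟨-, hp⟩, ht⟩
      by_contra hcon
      obtain ⟨i', j', h3, h4, -⟩ := exists_some_of_le hmono hx (show t ≤ n by omega) h1
      rw [ht] at h3
      simp only [Option.some.injEq, Prod.mk.injEq] at h3 hp
      omega

end Trajectory

/-! ### The law of the walk -/

namespace IsAbsorbedWalk

variable {Ω : Type*} [MeasurableSpace Ω] {μ : Measure Ω} [IsProbabilityMeasure μ]
  {Γ : Region} {w : StepWeights} {a b : ℤ} {X : ℕ → Ω → Option (ℤ × ℤ)}

/-- Almost surely, the walk starts at its initial state and makes only possible transitions. -/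
lemma ae_trajectory (hX : IsAbsorbedWalk μ Γ w (0, a) X) :
    ∀ᵐ ω ∂μ, X 0 ω = some (0, a) ∧ ∀ t, stepProb Γ w (X t ω) (X (t + 1) ω) ≠ 0 := by
  have key : ∀ n : ℕ, ∀ᵐ ω ∂μ, X 0 ω = some (0, a) ∧
      stepProb Γ w (X n ω) (X (n + 1) ω) ≠ 0 := by
    intro n
    -- The exceptional set is a countable union of null cylinders.
    let ext (x : Fin (n + 2) → Option (ℤ × ℤ)) (t : ℕ) : Option (ℤ × ℤ) :=
      if h : t < n + 2 then x ⟨t, h⟩ else none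
    have hsub : {ω | ¬ (X 0 ω = some (0, a) ∧ stepProb Γ w (X n ω) (X (n + 1) ω) ≠ 0)} ⊆
        ⋃ x : {x : Fin (n + 2) → Option (ℤ × ℤ) //
          ¬ (ext x 0 = some (0, a) ∧ stepProb Γ w (ext x n) (ext x (n + 1)) ≠ 0)},
          {ω | ∀ t ≤ n + 1, X t ω = ext x.1 t} := by
      intro ω hω
      have he : ∀ t ≤ n + 1, X t ω = ext (fun s => X s ω) t := fun t ht => by
        simp only [ext]
        rw [dif_pos (by omega)]
      refine Set.mem_iUnion.2 ⟨⟨fun s => X s ω, ?_⟩, he⟩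
      rw [← he 0 (by omega), ← he n (by omega), ← he (n + 1) le_rfl]
      exact hω
    refine measure_mono_null hsub (measure_iUnion_null ?_)
    rintro ⟨x, hx⟩
    rw [← measureReal_eq_zero_iff, hX.law (n + 1) (ext x)]
    by_cases h0 : ext x 0 = some (0, a)
    · have h1 : stepProb Γ w (ext x n) (ext x (n + 1)) = 0 := by
        by_contra h1
        exact hx ⟨h0, h1⟩
      rw [Finset.prod_range_succ, h1, mul_zero, mul_zero]
    · rw [if_neg h0, zero_mul]
  filter_upwards [ae_all_iff.2 key] with ω hω
  exact ⟨(hω 0).1, fun t => (hω t).2⟩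

/-- The probability of an event which almost surely splits according to two values of the state at
some time. -/
lemma measureReal_eq_add (hX : IsAbsorbedWalk μ Γ w (0, a) X) {E : Set Ω}
    (n : ℕ) {p q : ℤ × ℤ} (hpq : p ≠ q)
    (h : ∀ ω ∈ E, (∀ t, stepProb Γ w (X t ω) (X (t + 1) ω) ≠ 0) →
      X n ω = some p ∨ X n ω = some q) :
    μ.real E = μ.real (E ∩ {ω | X n ω = some p}) + μ.real (E ∩ {ω | X n ω = some q}) := by
  have h1 := measureReal_inter_add_sdiff (μ := μ) (s := E) (hX.measurableSet_eq n (some p))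
  rw [← h1]
  congr 1
  refine measureReal_congr ?_
  filter_upwards [hX.ae_trajectory] with ω hω
  refine propext ⟨fun hE => ?_, fun hE => ?_⟩
  · exact ⟨hE.1, (h ω hE.1 hω.2).resolve_left hE.2⟩
  · refine ⟨hE.1, fun h' => hpq ?_⟩
    have h2 : X n ω = some q := hE.2
    have h3 : X n ω = some p := h'
    exact Option.some_injective _ (h3.symm.trans h2)

/-- The probability of observing a given segment of a trajectory from time `n` on. -/
lemma measureReal_segment (hX : IsAbsorbedWalk μ Γ w (0, a) X) (hmono : w.IsMonotone Γ)
    (n : ℕ) : ∀ (s : ℕ) (x : ℕ → Option (ℤ × ℤ)) (i j : ℤ), x 0 = some (i, j) →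
      μ.real {ω | ∀ t ≤ s, X (n + t) ω = x t} =
        fwd Γ w a n i j * ∏ t ∈ Finset.range s, stepProb Γ w (x t) (x (t + 1)) := by
  induction n with
  | zero =>
    intro s x i j hx
    have := hX.law s x
    simp only [zero_add]
    rw [this, hx, fwd]
    simp
  | succ n ih =>
    intro s x i j hx
    rw [hX.measureReal_eq_add n (p := (i - 1, j)) (q := (i, j - 1)) (by simp)]
    · have key : ∀ p : ℤ × ℤ,
          μ.real ({ω | ∀ t ≤ s, X (n + 1 + t) ω = x t} ∩ {ω | X n ω = some p}) =
            fwd Γ w a n p.1 p.2 * (stepProb Γ w (some p) (some (i, j)) *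
              ∏ t ∈ Finset.range s, stepProb Γ w (x t) (x (t + 1))) := by
        intro p
        have := ih (s + 1) (fun t => Nat.casesOn t (some p) x) p.1 p.2 rfl
        rw [Finset.prod_range_succ'] at this
        rw [← hx, mul_comm (stepProb Γ w _ _)]
        refine Eq.trans (congrArg μ.real ?_) this
        ext ω
        simp only [Set.mem_inter_iff, Set.mem_ofPred_eq]
        constructor
        · rintro ⟨h1, h2⟩ t ht
          cases t with
          | zero => exact h2
          | succ t => rw [show n + (t + 1) = n + 1 + t by ring]; exact h1 t (by omega)
        · intro h
          refine ⟨fun t ht => ?_, h 0 (by omega)⟩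
          rw [show n + 1 + t = n + (t + 1) by ring]
          exact h (t + 1) (by omega)
      have hr := stepProb_right (Γ := Γ) (w := w) (i - 1) j
      have hup := stepProb_up (Γ := Γ) (w := w) i (j - 1)
      rw [sub_add_cancel] at hr hup
      rw [key, key, hr, hup, fwd]
      ring
    · intro ω hω hgood
      have h1 := hω 0 (by omega)
      have h2 := hgood n
      rw [add_zero] at h1
      rw [h1, hx] at h2
      rcases exists_of_stepProb_ne_zero hmono h2 with ⟨h, -⟩ | ⟨h, -⟩
      exacts [Or.inl h, Or.inr h]

/-- The probability of observing a given segment of a trajectory from time `n` on, and of being at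
`(m, b)` at a later time. -/
lemma measureReal_segment_inter (hX : IsAbsorbedWalk μ Γ w (0, a) X) (hmono : w.IsMonotone Γ)
    (n r : ℕ) : ∀ (s : ℕ) (x : ℕ → Option (ℤ × ℤ)) (i₀ j₀ i j : ℤ), x 0 = some (i₀, j₀) →
      x s = some (i, j) →
      μ.real ({ω | ∀ t ≤ s, X (n + t) ω = x t} ∩ {ω | X (n + s + r) ω = some (Γ.m, b)}) =
        fwd Γ w a n i₀ j₀ * (∏ t ∈ Finset.range s, stepProb Γ w (x t) (x (t + 1))) *
          bwd Γ w b r i j := by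
  induction r with
  | zero =>
    intro s x i₀ j₀ i j h0 hs
    rw [bwd, ← hX.measureReal_segment hmono n s x i₀ j₀ h0]
    split_ifs with h
    · rw [mul_one]
      congr 1
      refine Set.inter_eq_left.2 fun ω hω => ?_
      have := hω s le_rfl
      rw [hs, h.1, h.2] at this
      exact this
    · rw [mul_zero]
      convert measureReal_empty (μ := μ)
      refine Set.eq_empty_of_forall_notMem ?_
      rintro ω ⟨h1, h2⟩
      have h3 := h1 s le_rfl
      have h2 : X (n + s) ω = some (Γ.m, b) := h2
      rw [h2, hs] at h3
      simp only [Option.some.injEq, Prod.mk.injEq] at h3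
      exact h ⟨h3.1.symm, h3.2.symm⟩
  | succ r ih =>
    intro s x i₀ j₀ i j h0 hs
    rw [hX.measureReal_eq_add (n + s + 1) (p := (i + 1, j)) (q := (i, j + 1)) (by simp)]
    · have key : ∀ p : ℤ × ℤ,
          μ.real ({ω | ∀ t ≤ s, X (n + t) ω = x t} ∩ {ω | X (n + s + (r + 1)) ω = some (Γ.m, b)}
            ∩ {ω | X (n + s + 1) ω = some p}) =
            fwd Γ w a n i₀ j₀ * ((∏ t ∈ Finset.range s, stepProb Γ w (x t) (x (t + 1))) *
              stepProb Γ w (some (i, j)) (some p)) * bwd Γ w b r p.1 p.2 := by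
        intro p
        have := ih (s + 1) (Function.update x (s + 1) (some p)) i₀ j₀ p.1 p.2
          (by rw [Function.update_of_ne (by omega), h0]) (by simp)
        have hupd : ∀ t ≤ s, Function.update x (s + 1) (some p) t = x t := fun t ht =>
          Function.update_of_ne (by omega) _ _
        rw [Finset.prod_range_succ, Function.update_self, hupd s le_rfl, hs,
          Finset.prod_congr rfl (fun t ht => by
            have := Finset.mem_range.1 ht
            rw [hupd t (by omega), hupd (t + 1) (by omega)])] at this
        rw [← this]
        congr 1
        ext ω
        simp only [Set.mem_inter_iff, Set.mem_ofPred_eq]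
        rw [show n + (s + 1) + r = n + s + (r + 1) by ring]
        constructor
        · rintro ⟨⟨h1, h2⟩, h3⟩
          refine ⟨fun t ht => ?_, h2⟩
          rcases Nat.lt_or_ge s t with h | h
          · obtain rfl : t = s + 1 := by omega
            rw [Function.update_self]; exact h3
          · rw [hupd t h]; exact h1 t h
        · rintro ⟨h1, h2⟩
          refine ⟨⟨fun t ht => ?_, h2⟩, ?_⟩
          · rw [h1 t (by omega), hupd t ht]
          · have := h1 (s + 1) le_rfl
            rwa [Function.update_self] at this
      rw [key, key, stepProb_right, stepProb_up, bwd]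
      ring
    · rintro ω ⟨h1, h2⟩ hgood
      -- The walk has not been absorbed by time `n + s + 1`, because it is at `(m, b)` later.
      obtain ⟨i', j', h3, -, -⟩ := exists_some_of_le (x := fun t => X t ω) hmono hgood
        (show n + s + 1 ≤ n + s + (r + 1) by omega) h2
      have h4 := hgood (n + s)
      have h3 : X (n + s + 1) ω = some (i', j') := h3
      rw [h1 s le_rfl, hs, h3] at h4
      rw [h3]
      rcases exists_of_stepProb_ne_zero hmono h4 with ⟨h, -⟩ | ⟨h, -⟩
      · left
        simp only [Option.some.injEq, Prod.mk.injEq] at h ⊢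
        omega
      · right
        simp only [Option.some.injEq, Prod.mk.injEq] at h ⊢
        omega

/-- The hitting probability factors into the three independent pieces of the walk: up to the edge
which enters column `ℓ`, across this edge, and from there to `(m, b)`. -/
lemma jointHitProb_eq (hX : IsAbsorbedWalk μ Γ w (0, a) X) (hmono : w.IsMonotone Γ) {ℓ : ℤ}
    (hℓ0 : 0 < ℓ) (hℓm : ℓ < Γ.m) {u : ℕ} (hu : (u : ℤ) = Γ.m + b - a) (k : ℤ) :
    jointHitProb μ Γ X (Γ.m, b) u ℓ k =
      visit Γ w a (ℓ - 1) k * rightWeight Γ w (ℓ - 1) k * reach Γ w b ℓ k := by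
  by_cases hnr : 0 ≤ ℓ - 1 + k - a ∧ 0 ≤ Γ.m + b - ℓ - k
  · obtain ⟨n, hn⟩ := Int.eq_ofNat_of_zero_le hnr.1
    obtain ⟨r, hr⟩ := Int.eq_ofNat_of_zero_le hnr.2
    have hur : n + 1 + r = u := by omega
    let x : ℕ → Option (ℤ × ℤ) := fun t => if t = 0 then some (ℓ - 1, k) else some (ℓ, k)
    have key := hX.measureReal_segment_inter (b := b) hmono n r 1 x (ℓ - 1) k ℓ k rfl rfl
    have hstep : stepProb Γ w (x 0) (x 1) = rightWeight Γ w (ℓ - 1) k := by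
      have := stepProb_right (Γ := Γ) (w := w) (ℓ - 1) k
      rwa [sub_add_cancel] at this
    rw [Finset.prod_range_one, zero_add, hstep, hur] at key
    rw [visit, reach, show (ℓ - 1 + k - a).toNat = n by omega,
      show (Γ.m + b - ℓ - k).toNat = r by omega, ← key]
    refine measureReal_congr ?_
    filter_upwards [hX.ae_trajectory] with ω hω
    refine propext (and_congr_left fun hωu => ?_)
    refine (isLeast_iff (x := fun t => X t ω) hmono hω.2 hℓ0 hℓm hω.1 hωu).trans ⟨?_, ?_⟩
    · rintro ⟨n', r', hn', -, h1, h2⟩ t ht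
      obtain rfl : n' = n := by omega
      interval_cases t
      exacts [h1, h2]
    · intro h
      exact ⟨n, r, by omega, hur, h 0 (by omega), h 1 le_rfl⟩
  · -- The time is out of range, and both sides vanish.
    have hzero : visit Γ w a (ℓ - 1) k * rightWeight Γ w (ℓ - 1) k * reach Γ w b ℓ k = 0 := by
      by_cases h1 : 0 ≤ ℓ - 1 + k - a
      · rw [reach, show (Γ.m + b - ℓ - k).toNat = 0 by omega, bwd, if_neg (by omega), mul_zero]
      · rw [visit, show (ℓ - 1 + k - a).toNat = 0 by omega, fwd, if_neg (by omega), zero_mul,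
          zero_mul]
    rw [hzero, ← measureReal_empty (μ := μ)]
    refine measureReal_congr ?_
    filter_upwards [hX.ae_trajectory] with ω hω
    refine propext ⟨?_, False.elim⟩
    rintro ⟨h1, h2⟩
    obtain ⟨n, r, hn, hr, -, -⟩ :=
      (isLeast_iff (x := fun t => X t ω) hmono hω.2 hℓ0 hℓm hω.1 h2).1 h1
    exact hnr ⟨by omega, by omega⟩

end IsAbsorbedWalk

end MonotoneWalk

/-! ### Log-concavity of the hitting probability -/

theorem corollary4p2 {Ω : Type*} [MeasurableSpace Ω] (μ : MeasureTheory.Measure Ω)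
    [MeasureTheory.IsProbabilityMeasure μ]
    (Γ : MonotoneWalk.Region) (ℓ : ℤ) (hℓ0 : 0 < ℓ) (hℓm : ℓ < Γ.m)
    (a b : ℤ) (hA : (0, a) ∈ Γ.alpha) (hB : (Γ.m, b) ∈ Γ.beta)
    (w : MonotoneWalk.StepWeights) (hw : w.IsTransition Γ) (hinv : w.YInvariant)
    (hmono : w.IsMonotone Γ)
    (X : ℕ → Ω → Option (ℤ × ℤ)) (hX : MonotoneWalk.IsAbsorbedWalk μ Γ w (0, a) X)
    (u : ℕ) (hu : (u : ℤ) = Γ.m + b - a)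
    (k : ℤ) (hk₁ : (ℓ, k + 1) ∈ Γ.gamma ℓ) (hk₂ : (ℓ, k - 1) ∈ Γ.gamma ℓ) :
    MonotoneWalk.jointHitProb μ Γ X (Γ.m, b) u ℓ (k + 1) *
          MonotoneWalk.jointHitProb μ Γ X (Γ.m, b) u ℓ (k - 1) ≤
        MonotoneWalk.jointHitProb μ Γ X (Γ.m, b) u ℓ k ^ 2 ∧
      MonotoneWalk.condHitProb μ Γ X (Γ.m, b) u ℓ (k + 1) *
          MonotoneWalk.condHitProb μ Γ X (Γ.m, b) u ℓ (k - 1) ≤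
        MonotoneWalk.condHitProb μ Γ X (Γ.m, b) u ℓ k ^ 2 := by
  have hlc : MonotoneWalk.IsLogConcave (MonotoneWalk.jointHitProb μ Γ X (Γ.m, b) u ℓ) := by
    have hf := MonotoneWalk.isLogConcave_visit hw hinv (Γ.alpha_subset_points hA) (ℓ - 1).toNat
    have hg := MonotoneWalk.isLogConcave_reach hw hinv (Γ.beta_subset_points hB) (Γ.m - ℓ).toNat
    rw [show ((ℓ - 1).toNat : ℤ) = ℓ - 1 by omega] at hf
    rw [show Γ.m - ((Γ.m - ℓ).toNat : ℤ) = ℓ by omega] at hg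
    convert (hf.mul (MonotoneWalk.isLogConcave_rightWeight hw hinv (ℓ - 1))).mul hg using 1
    funext k
    exact hX.jointHitProb_eq hmono hℓ0 hℓm hu k
  have hjoint := hlc.mul_le k k le_rfl
  have hcond : ∀ k, MonotoneWalk.condHitProb μ Γ X (Γ.m, b) u ℓ k =
      (μ.real {ω | X u ω = some (Γ.m, b)})⁻¹ *
        MonotoneWalk.jointHitProb μ Γ X (Γ.m, b) u ℓ k := fun k => by
    rw [MonotoneWalk.condHitProb, MonotoneWalk.jointHitProb, Set.inter_comm,
      MeasureTheory.measureReal_def, ProbabilityTheory.cond_apply (hX.measurableSet_eq _ _),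
      ENNReal.toReal_mul, ENNReal.toReal_inv]
    rfl
  refine ⟨by linarith, ?_⟩
  rw [hcond, hcond, hcond]
  have := mul_le_mul_of_nonneg_left hjoint (sq_nonneg (μ.real {ω | X u ω = some (Γ.m, b)})⁻¹)
  linarith
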